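/- Let $H_1,H_2$ be real Hilbert spaces, let $C\subset H_1$ and $Q\subset H_2$ be nonempty, closed and convex with metric projections $P_C,P_Q$, and let $A:H_1\to H_2$ be a bounded linear operator with adjoint $A^*$. Let $f_1:H_1\to H_1$ and $f_2:H_2\to H_2$ be $\tau_1$- and $\tau_2$-inverse strongly monotone, respectively, i.e. $\tau_i>0$ and $\langle f_i(x)-f_i(y),x-y\rangle\ge\tau_i\|f_i(x)-f_i(y)\|^2$ for all $x,y\in H_i$. Let $F:H_1\to H_1$ be $L$-Lipschitz continuous and $\gamma$-strongly monotone, i.e. $\gamma>0$ and $\langle F(x)-F(y),x-y\rangle\ge\gamma\|x-y\|^2$ for all $x,y\in H_1$. Assume that the solution set of the split variational inequality problem (SVIP), $$\Omega=\{x^*\in C:\ \langle f_1(x^*),x-x^*\rangle\ge 0\ \ \forall x\in C,\ \text{ and } y^*=Ax^*\in Q \text{ satisfies } \langle f_2(y^*),y-y^*\rangle\ge 0\ \ \forall y\in Q\},$$ is nonempty. Let $(\alpha_n)_{n\ge1}$ and $(\lambda_n)_{n\ge1}$ be real sequences such that - (C1) $\alpha_n\in(0,1)$ for all $n$, $\lim_{n\to\infty}\alpha_n=0$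 and $\sum_{n=1}^\infty\alpha_n=\infty$; - (C2) $\lim_{n\to\infty}|\alpha_{n+1}-\alpha_n|/\alpha_n^2=0$; - (B3) there are constants $c>0$ and $\rho>2$ with $c<\lambda_n<\frac1\rho\min\{\tau_1,\tau_2,1/\|A\|^2\}$ for all $n$ (where $1/\|A\|^2=+\infty$ if $A=0$). Let $z_1\in H_1$ be arbitrary and, for $n\ge1$, $$z_{n+1}=P_C\bigl(z_n-\lambda_n f_1(z_n)-\lambda_n A^*(I-P_Q(I-\lambda_n f_2))Az_n-\lambda_n\alpha_nF(z_n)\bigr).$$ Then $(z_n)$ converges strongly to a point $u\in\Omega$, and $u$ is the unique point of $\Omega$ satisfying $\langle F(u),x-u\rangle\ge0$ for all $x\in\Omega$. -/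

import Mathlib

open Filter Topology
open scoped RealInnerProductSpace NNReal

/-- `f` is `η`-inverse strongly monotone (`η`-ism). -/
def IsInverseStronglyMonotone {H : Type*} [NormedAddCommGroup H] [InnerProductSpace ℝ H]
    (η : ℝ) (f : H → H) : Prop :=
  0 < η ∧ ∀ x y : H, η * ‖f x - f y‖ ^ 2 ≤ ⟪f x - f y, x - y⟫

/-- `f` is `γ`-strongly monotone. -/
def IsStronglyMonotone {H : Type*} [NormedAddCommGroup H] [InnerProductSpace ℝ H]
    (γ : ℝ) (f : H → H) : Prop :=
  0 < γ ∧ ∀ x y : H, γ * ‖x - y‖ ^ 2 ≤ ⟪f x - f y, x - y⟫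

/-- The solutions of the variational inequality
"find `x ∈ C` with `⟪f x, y - x⟫ ≥ 0` for all `y ∈ C`". -/
def viSolutions {H : Type*} [NormedAddCommGroup H] [InnerProductSpace ℝ H]
    (f : H → H) (C : Set H) : Set H :=
  {x | x ∈ C ∧ ∀ y ∈ C, 0 ≤ ⟪f x, y - x⟫}

/-- The solutions of the split variational inequality problem: the `x` that solve the variational
inequality of `f₁` on `C` and whose image `A x` solves that of `f₂` on `Q`. -/
def svipSolutions {H₁ H₂ : Type*} [NormedAddCommGroup H₁] [InnerProductSpace ℝ H₁]
    [NormedAddCommGroup H₂] [InnerProductSpace ℝ H₂]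
    (f₁ : H₁ → H₁) (f₂ : H₂ → H₂) (C : Set H₁) (Q : Set H₂) (A : H₁ →L[ℝ] H₂) : Set H₁ :=
  {x | x ∈ viSolutions f₁ C ∧ A x ∈ viSolutions f₂ Q}

open Classical in
/-- The metric projection: `metricProj C x` is the point of `C` nearest to `x`. For nonempty closed
convex `C` in a Hilbert space it exists and is unique, see `metricProj_spec` and
`metricProj_unique`; if there is no nearest point the value is `x` (never relevant there). -/
noncomputable def metricProj {H : Type*} [NormedAddCommGroup H] [InnerProductSpace ℝ H]
    (C : Set H) (x : H) : H :=
  if h : ∃ p ∈ C, ∀ y ∈ C, ‖x - p‖ ≤ ‖x - y‖ then h.choose else x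

theorem metricProj_spec {H : Type*} [NormedAddCommGroup H] [InnerProductSpace ℝ H]
    [CompleteSpace H] {C : Set H} (hne : C.Nonempty) (hcl : IsClosed C) (hcv : Convex ℝ C) (x : H) :
    metricProj C x ∈ C ∧ ∀ y ∈ C, ‖x - metricProj C x‖ ≤ ‖x - y‖ := by
  have h : ∃ p ∈ C, ∀ y ∈ C, ‖x - p‖ ≤ ‖x - y‖ := by
    obtain ⟨p, hp, hpe⟩ := exists_norm_eq_iInf_of_complete_convex hne hcl.isComplete hcv x
    refine ⟨p, hp, fun y hy => ?_⟩
    rw [hpe]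
    exact ciInf_le (f := fun w : C => ‖x - w‖)
      ⟨0, by rintro _ ⟨w, rfl⟩; exact norm_nonneg _⟩ ⟨y, hy⟩
  unfold metricProj
  rw [dif_pos h]
  exact h.choose_spec

theorem metricProj_unique {H : Type*} [NormedAddCommGroup H] [InnerProductSpace ℝ H]
    [CompleteSpace H] {C : Set H} (hcl : IsClosed C) (hcv : Convex ℝ C) {x p : H}
    (hp : p ∈ C) (hmin : ∀ y ∈ C, ‖x - p‖ ≤ ‖x - y‖) : metricProj C x = p := by
  have key : ∀ q ∈ C, (∀ y ∈ C, ‖x - q‖ ≤ ‖x - y‖) → ∀ w ∈ C, ⟪x - q, w - q⟫ ≤ 0 := by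
    intro q hq hqm
    have : Nonempty C := ⟨⟨q, hq⟩⟩
    refine (norm_eq_iInf_iff_real_inner_le_zero hcv hq).1 (le_antisymm ?_ ?_)
    · exact le_ciInf fun w => hqm w w.2
    · exact ciInf_le (f := fun w : C => ‖x - w‖)
        ⟨0, by rintro _ ⟨w, rfl⟩; exact norm_nonneg _⟩ ⟨q, hq⟩
  obtain ⟨hm, hmm⟩ := metricProj_spec ⟨p, hp⟩ hcl hcv x
  have h1 := key _ hm hmm p hp
  have h2 := key p hp hmin _ hm
  have h3 : ⟪metricProj C x - p, metricProj C x - p⟫ ≤ 0 := by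
    simp only [inner_sub_left, inner_sub_right] at h1 h2 ⊢
    have e1 := real_inner_comm p (metricProj C x)
    linarith
  rw [real_inner_self_eq_norm_sq] at h3
  exact sub_eq_zero.1 (norm_eq_zero.1 (pow_eq_zero_iff two_ne_zero |>.1 (le_antisymm h3 (sq_nonneg _))))

/-- One step `z ↦ P_C (z - lam f₁ z - lam A* (I - P_Q (I - lam f₂)) A z - lam a F z)` of the projected
regularized iteration with step size `lam` and regularization parameter `a`. -/
noncomputable def svipStep {H₁ H₂ : Type*} [NormedAddCommGroup H₁] [InnerProductSpace ℝ H₁]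
    [CompleteSpace H₁] [NormedAddCommGroup H₂] [InnerProductSpace ℝ H₂] [CompleteSpace H₂]
    (f₁ : H₁ → H₁) (f₂ : H₂ → H₂) (F : H₁ → H₁) (C : Set H₁) (Q : Set H₂) (A : H₁ →L[ℝ] H₂)
    (lam a : ℝ) (z : H₁) : H₁ :=
  metricProj C (z - lam • f₁ z
    - lam • (ContinuousLinearMap.adjoint A) (A z - metricProj Q (A z - lam • f₂ (A z)))
    - (lam * a) • F z)

/-!
Every step is `z ↦ P_C (T_n z - lam_n α_n F z)` with
`T_n = I - lam_n (f₁ + A* (I - P_Q (I - lam_n f₂)) A)`, and for each solution `u` of the split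
problem `P_C (T_n u) = u`. Inverse strong monotonicity of `f₁` and of `I - P_Q (I - lam_n f₂)`, with
the bound on the step sizes, makes `P_C ∘ T_n` strongly nonexpansive around `u`, while strong
monotonicity of `F` makes the regularization contract squared distances by `1 - lam_n α_n γ`. Let
`u` be the solution of the variational inequality of `F` on the solution set, which exists by
Banach's fixed point theorem (`exists_mem_viSolutions`). The squared distances `s_n = ‖z_n - u‖²`
then satisfy `s_{n+1} ≤ (1 - β_n) s_n - g_n + β_n e_n`, where `β_n = lam_n α_n γ`, the gain
`g_n ≥ 0` bounds the squared displacement of `z_n` under `P_C ∘ T_n` up to a constant factor and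
terms that vanish with `α_n`, and `e_n` is `-(2 / γ) ⟪F u, z_n - u⟫` up to terms that vanish with
`g_n` and `α_n`.

Such a recursion forces `s_n → 0` if `limsup e_n ≤ 0` merely along indices with `g_n → 0`
(`tendsto_zero_of_recursion_with_gain`): at all other indices the gain outweighs the error. Along
an ultrafilter on which `g_n → 0`, the bounded sequence `z_n` converges weakly, and a demiclosedness
argument based on Minty's lemma (`mem_viSolutions_of_tendsto_inner`), applied to `f₁` on `C` and to
`f₂` on `Q`, shows that the weak limit `z₀` solves the split problem; hence
`lim e_n = -(2 / γ) ⟪F u, z₀ - u⟫ ≤ 0` by the choice of `u`.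
-/

/-! ### Metric projections -/

section MetricProjection

variable {H : Type*} [NormedAddCommGroup H] [InnerProductSpace ℝ H]

theorem metricProj_eq_of_inner_le [CompleteSpace H] {C : Set H} (hcl : IsClosed C)
    (hcv : Convex ℝ C) {x p : H} (hp : p ∈ C) (h : ∀ y ∈ C, ⟪x - p, y - p⟫ ≤ 0) :
    metricProj C x = p := by
  refine metricProj_unique hcl hcv hp fun y hy => ?_
  have h1 : ‖x - y‖ ^ 2 = ‖x - p‖ ^ 2 - 2 * ⟪x - p, y - p⟫ + ‖y - p‖ ^ 2 := by
    rw [← norm_sub_sq_real, sub_sub_sub_cancel_right]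
  have h2 := h y hy
  refine le_of_sq_le_sq ?_ (norm_nonneg _)
  nlinarith [sq_nonneg ‖y - p‖]

theorem inner_sub_metricProj_le [CompleteSpace H] {C : Set H} (hcl : IsClosed C)
    (hcv : Convex ℝ C) (x : H) {y : H} (hy : y ∈ C) :
    ⟪x - metricProj C x, y - metricProj C x⟫ ≤ 0 := by
  obtain ⟨hp, hmin⟩ := metricProj_spec ⟨y, hy⟩ hcl hcv x
  have : Nonempty C := ⟨⟨y, hy⟩⟩
  refine (norm_eq_iInf_iff_real_inner_le_zero hcv hp).1 (le_antisymm ?_ ?_) y hy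
  · exact le_ciInf fun w => hmin w w.2
  · exact ciInf_le (f := fun w : C => ‖x - w‖)
      ⟨0, by rintro _ ⟨w, rfl⟩; exact norm_nonneg _⟩ ⟨_, hp⟩

/-- The metric projection is firmly nonexpansive. -/
theorem norm_metricProj_sub_sq_add_le [CompleteSpace H] {C : Set H} (hne : C.Nonempty)
    (hcl : IsClosed C) (hcv : Convex ℝ C) (x y : H) :
    ‖metricProj C x - metricProj C y‖ ^ 2
      + ‖(x - y) - (metricProj C x - metricProj C y)‖ ^ 2 ≤ ‖x - y‖ ^ 2 := by
  have hx := inner_sub_metricProj_le hcl hcv x (metricProj_spec hne hcl hcv y).1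
  have hy := inner_sub_metricProj_le hcl hcv y (metricProj_spec hne hcl hcv x).1
  set p := metricProj C x
  set q := metricProj C y
  have e1 : ⟪x - p, q - p⟫ + ⟪y - q, p - q⟫ = ⟪p - q, p - q⟫ - ⟪x - y, p - q⟫ := by
    rw [← neg_sub p q, inner_neg_right, ← inner_sub_left, neg_add_eq_sub, ← inner_sub_left]
    congr 1
    abel
  rw [real_inner_self_eq_norm_sq] at e1
  rw [norm_sub_sq_real (x - y)]
  linarith

theorem norm_metricProj_sub_le [CompleteSpace H] {C : Set H} (hne : C.Nonempty)
    (hcl : IsClosed C) (hcv : Convex ℝ C) (x y : H) :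
    ‖metricProj C x - metricProj C y‖ ≤ ‖x - y‖ := by
  refine le_of_sq_le_sq ?_ (norm_nonneg _)
  nlinarith [norm_metricProj_sub_sq_add_le hne hcl hcv x y,
    sq_nonneg ‖(x - y) - (metricProj C x - metricProj C y)‖]

end MetricProjection

/-! ### Monotone variational inequalities -/

section VariationalInequality

variable {H : Type*} [NormedAddCommGroup H] [InnerProductSpace ℝ H]

theorem IsInverseStronglyMonotone.inner_nonneg {τ : ℝ} {f : H → H}
    (hf : IsInverseStronglyMonotone τ f) (x y : H) : 0 ≤ ⟪f x - f y, x - y⟫ :=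
  le_trans (mul_nonneg hf.1.le (sq_nonneg _)) (hf.2 x y)

theorem IsInverseStronglyMonotone.lipschitzWith {τ : ℝ} {f : H → H}
    (hf : IsInverseStronglyMonotone τ f) : LipschitzWith (Real.toNNReal τ⁻¹) f := by
  refine LipschitzWith.of_dist_le' fun x y => ?_
  rw [dist_eq_norm, dist_eq_norm]
  rcases (norm_nonneg (f x - f y)).eq_or_lt with h0 | h0
  · rw [← h0]
    exact mul_nonneg (inv_nonneg.2 hf.1.le) (norm_nonneg _)
  · rw [← div_eq_inv_mul, le_div_iff₀ hf.1]
    have := (hf.2 x y).trans (real_inner_le_norm _ _)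
    refine le_of_mul_le_mul_left ?_ h0
    linarith

theorem metricProj_eq_of_mem_viSolutions [CompleteSpace H] {C : Set H} (hcl : IsClosed C)
    (hcv : Convex ℝ C) {f : H → H} {p : H} (hp : p ∈ viSolutions f C) {lam : ℝ} (hlam : 0 ≤ lam) :
    metricProj C (p - lam • f p) = p := by
  refine metricProj_eq_of_inner_le hcl hcv hp.1 fun y hy => ?_
  rw [sub_sub_cancel_left, inner_neg_left, inner_smul_left]
  simpa using mul_nonneg hlam (hp.2 y hy)

/-- Minty's lemma: for monotone continuous `f`, the values of `f` at the solution can be traded for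
its values at the test points, which makes the condition linear in the solution. -/
theorem mem_viSolutions_iff_minty {C : Set H} (hcv : Convex ℝ C) {f : H → H}
    (hmono : ∀ x y, 0 ≤ ⟪f x - f y, x - y⟫) (hcont : Continuous f) {x : H} :
    x ∈ viSolutions f C ↔ x ∈ C ∧ ∀ y ∈ C, 0 ≤ ⟪f y, y - x⟫ := by
  refine ⟨fun h => ⟨h.1, fun y hy => ?_⟩, fun h => ⟨h.1, fun y hy => ?_⟩⟩
  · have h1 := hmono y x
    have h2 := h.2 y hy
    rw [inner_sub_left] at h1
    linarith
  · -- test with the points `x + t (y - x)` and let `t` decrease to `0`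
    have hlim : Tendsto (fun t : ℝ => ⟪f (x + t • (y - x)), y - x⟫) (𝓝[>] 0)
        (𝓝 ⟪f x, y - x⟫) := by
      have hc : Continuous fun t : ℝ => ⟪f (x + t • (y - x)), y - x⟫ := by fun_prop
      simpa using (hc.tendsto 0).mono_left nhdsWithin_le_nhds
    refine ge_of_tendsto hlim ?_
    filter_upwards [Ioo_mem_nhdsGT (zero_lt_one (α := ℝ))] with t ht
    have := h.2 _ (hcv.add_smul_sub_mem h.1 hy ⟨ht.1.le, ht.2.le⟩)
    rw [add_sub_cancel_left, inner_smul_right] at this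
    exact nonneg_of_mul_nonneg_right this ht.1

theorem viSolutions_eq_inter_minty {C : Set H} (hcv : Convex ℝ C) {f : H → H}
    (hmono : ∀ x y, 0 ≤ ⟪f x - f y, x - y⟫) (hcont : Continuous f) :
    viSolutions f C = C ∩ ⋂ y ∈ C, {x | ⟪f y, x⟫ ≤ ⟪f y, y⟫} := by
  ext x
  simp [mem_viSolutions_iff_minty hcv hmono hcont, inner_sub_right]

theorem isClosed_viSolutions {C : Set H} (hcl : IsClosed C) (hcv : Convex ℝ C) {f : H → H}
    (hmono : ∀ x y, 0 ≤ ⟪f x - f y, x - y⟫) (hcont : Continuous f) :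
    IsClosed (viSolutions f C) := by
  rw [viSolutions_eq_inter_minty hcv hmono hcont]
  exact hcl.inter (isClosed_biInter fun y _ => isClosed_le (by fun_prop) continuous_const)

theorem convex_viSolutions {C : Set H} (hcv : Convex ℝ C) {f : H → H}
    (hmono : ∀ x y, 0 ≤ ⟪f x - f y, x - y⟫) (hcont : Continuous f) :
    Convex ℝ (viSolutions f C) := by
  rw [viSolutions_eq_inter_minty hcv hmono hcont]
  exact hcv.inter (convex_iInter₂ fun y _ =>
    convex_halfSpace_le (innerSL ℝ (f y)).toLinearMap.isLinear _)

theorem viSolutions_unique {C : Set H} {F : H → H} {γ : ℝ} (hF : IsStronglyMonotone γ F) {u v : H}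
    (hu : u ∈ viSolutions F C) (hv : v ∈ viSolutions F C) : v = u := by
  have h1 := hu.2 v hv.1
  have h2 := hv.2 u hu.1
  have h3 := hF.2 v u
  rw [← neg_sub v u, inner_neg_right] at h2
  rw [inner_sub_left] at h3
  have h4 : ‖v - u‖ ^ 2 ≤ 0 := by
    by_contra! h
    nlinarith [mul_pos hF.1 h]
  exact sub_eq_zero.1 (norm_eq_zero.1 (pow_eq_zero_iff two_ne_zero |>.1
    (le_antisymm h4 (sq_nonneg _))))

/-- Solutions are fixed points of `x ↦ P_C (x - μ F x)`, which is a contraction for small `μ`. -/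
theorem exists_mem_viSolutions [CompleteSpace H] {C : Set H} (hne : C.Nonempty) (hcl : IsClosed C)
    (hcv : Convex ℝ C) {F : H → H} {γ : ℝ} (hF : IsStronglyMonotone γ F) {L : ℝ≥0}
    (hL : LipschitzWith L F) : ∃ u, u ∈ viSolutions F C := by
  have hγ := hF.1
  set D : ℝ := (L : ℝ) ^ 2 + γ ^ 2 with hD
  have hDpos : 0 < D := by positivity
  -- with `μ = γ / (L² + γ²)` the squared contraction factor `1 - 2μγ + μ²L²` is at most `1 - μγ`
  set μ : ℝ := γ / D with hμ
  have hμpos : 0 < μ := by positivity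
  have hμD : μ * D = γ := by rw [hμ]; field_simp
  have hμL : μ * (L : ℝ) ^ 2 ≤ γ := by nlinarith [sq_nonneg γ]
  have hcontr : ContractingWith (Real.toNNReal (√(1 - μ * γ)))
      (fun x => metricProj C (x - μ • F x)) := by
    refine ⟨?_, LipschitzWith.of_dist_le' fun x y => ?_⟩
    · rw [Real.toNNReal_lt_one, Real.sqrt_lt' one_pos]
      nlinarith [mul_pos hμpos hγ]
    rw [dist_eq_norm, dist_eq_norm]
    refine (norm_metricProj_sub_le hne hcl hcv _ _).trans ?_
    have hFL : ‖F x - F y‖ ≤ L * ‖x - y‖ := hL.norm_sub_le x y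
    have h1 : ‖x - μ • F x - (y - μ • F y)‖ ^ 2 ≤ (1 - μ * γ) * ‖x - y‖ ^ 2 := by
      rw [sub_sub_sub_comm, ← smul_sub, norm_sub_sq_real, inner_smul_right, norm_smul, mul_pow,
        Real.norm_eq_abs, sq_abs, real_inner_comm]
      have h2 := hF.2 x y
      have h3 : ‖F x - F y‖ ^ 2 ≤ (L : ℝ) ^ 2 * ‖x - y‖ ^ 2 := by
        rw [← mul_pow]
        exact pow_le_pow_left₀ (norm_nonneg _) hFL 2
      have h4 : μ ^ 2 * ‖F x - F y‖ ^ 2 ≤ μ * γ * ‖x - y‖ ^ 2 := by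
        calc μ ^ 2 * ‖F x - F y‖ ^ 2 ≤ μ ^ 2 * ((L : ℝ) ^ 2 * ‖x - y‖ ^ 2) := by gcongr
          _ = μ * (μ * (L : ℝ) ^ 2) * ‖x - y‖ ^ 2 := by ring
          _ ≤ μ * γ * ‖x - y‖ ^ 2 := by gcongr
      have h5 := mul_le_mul_of_nonneg_left h2 hμpos.le
      linarith
    calc ‖x - μ • F x - (y - μ • F y)‖
        = √(‖x - μ • F x - (y - μ • F y)‖ ^ 2) := (Real.sqrt_sq (norm_nonneg _)).symm
      _ ≤ √((1 - μ * γ) * ‖x - y‖ ^ 2) := Real.sqrt_le_sqrt h1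
      _ = √(1 - μ * γ) * ‖x - y‖ := by
        rw [Real.sqrt_mul' _ (sq_nonneg _), Real.sqrt_sq (norm_nonneg _)]
  have : Nonempty H := ⟨hne.some⟩
  refine ⟨hcontr.fixedPoint, ?_⟩
  set u := hcontr.fixedPoint with hu
  have hfix : metricProj C (u - μ • F u) = u := hcontr.fixedPoint_isFixedPt
  refine ⟨hfix ▸ (metricProj_spec hne hcl hcv (u - μ • F u)).1, fun y hy => ?_⟩
  have h := inner_sub_metricProj_le hcl hcv (u - μ • F u) hy
  rw [hfix, sub_sub_cancel_left, inner_neg_left, inner_smul_left] at h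
  have h' : 0 ≤ μ * ⟪F u, y - u⟫ := by simpa using h
  exact nonneg_of_mul_nonneg_right h' hμpos

/-- For `0 ≤ lam ≤ 2τ` the map `S = P_Q (I - lam f)` is nonexpansive, so that `I - S` is
`1/2`-inverse strongly monotone. -/
theorem norm_sub_metricProj_sq_le [CompleteSpace H] {Q : Set H} (hne : Q.Nonempty)
    (hcl : IsClosed Q) (hcv : Convex ℝ Q) {f : H → H} {τ : ℝ}
    (hf : IsInverseStronglyMonotone τ f) {lam : ℝ} (hlam : 0 ≤ lam) (hlamτ : lam ≤ 2 * τ)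
    (x y : H) :
    1 / 2 * ‖(x - metricProj Q (x - lam • f x)) - (y - metricProj Q (y - lam • f y))‖ ^ 2
      ≤ ⟪(x - metricProj Q (x - lam • f x)) - (y - metricProj Q (y - lam • f y)), x - y⟫ := by
  have h1 := norm_metricProj_sub_le hne hcl hcv (x - lam • f x) (y - lam • f y)
  have h2 : ‖x - lam • f x - (y - lam • f y)‖ ^ 2 ≤ ‖x - y‖ ^ 2 := by
    rw [sub_sub_sub_comm, ← smul_sub, norm_sub_sq_real, inner_smul_right, norm_smul, mul_pow,
      Real.norm_eq_abs, sq_abs, real_inner_comm]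
    have h3 := mul_le_mul_of_nonneg_left (hf.2 x y) hlam
    have h4 : lam * lam * ‖f x - f y‖ ^ 2 ≤ lam * (2 * τ) * ‖f x - f y‖ ^ 2 := by gcongr
    linarith
  have h5 := (pow_le_pow_left₀ (norm_nonneg _) h1 2).trans h2
  set p := metricProj Q (x - lam • f x)
  set q := metricProj Q (y - lam • f y)
  have h6 : p - q = (x - y) - ((x - p) - (y - q)) := by abel
  rw [h6, norm_sub_sq_real, real_inner_comm] at h5
  linarith

end VariationalInequality

/-! ### Weak limits along ultrafilters -/

section WeakLimit

variable {H : Type*} [NormedAddCommGroup H] [InnerProductSpace ℝ H]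

/-- Weak compactness of balls, by the Banach–Alaoglu theorem and the Riesz representation. -/
theorem Ultrafilter.exists_tendsto_inner [CompleteSpace H] {ι : Type*} (U : Ultrafilter ι)
    {x : ι → H} {M : ℝ} (hx : ∀ i, ‖x i‖ ≤ M) :
    ∃ x₀ : H, ∀ h : H, Tendsto (fun i => ⟪h, x i⟫) U (𝓝 ⟪h, x₀⟫) := by
  let Φ : ι → WeakDual ℝ H := fun i => StrongDual.toWeakDual (InnerProductSpace.toDual ℝ H (x i))
  have hΦ : ∀ i, Φ i ∈ WeakDual.toStrongDual ⁻¹' Metric.closedBall (0 : StrongDual ℝ H) M := by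
    intro i
    simpa [Φ] using hx i
  obtain ⟨φ, -, hφ⟩ := (WeakDual.isCompact_closedBall (𝕜 := ℝ) (E := H) 0 M).ultrafilter_le_nhds
    (U.map Φ) (by
      rw [Filter.le_principal_iff]
      exact Ultrafilter.mem_map.2 (Filter.univ_mem' hΦ))
  refine ⟨(InnerProductSpace.toDual ℝ H).symm (WeakDual.toStrongDual φ), fun h => ?_⟩
  have h1 : Tendsto (fun i => Φ i h) U (𝓝 (φ h)) :=
    ((WeakDual.eval_continuous h).tendsto φ).comp hφ
  rw [real_inner_comm, InnerProductSpace.toDual_symm_apply]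
  refine h1.congr fun i => ?_
  simp [Φ, real_inner_comm]

theorem tendsto_inner_zero_of_bounded {ι : Type*} {l : Filter ι} {x y : ι → H} {M : ℝ}
    (hx : Tendsto x l (𝓝 0)) (hy : ∀ᶠ i in l, ‖y i‖ ≤ M) :
    Tendsto (fun i => ⟪x i, y i⟫) l (𝓝 0) := by
  refine squeeze_zero_norm' (a := fun i => ‖x i‖ * M) (hy.mono fun i hi => ?_) ?_
  · exact (norm_inner_le_norm _ _).trans (mul_le_mul_of_nonneg_left hi (norm_nonneg _))
  · simpa using hx.norm.mul_const M

/-- Adding a strongly null sequence does not change weak limits. -/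
theorem tendsto_inner_of_sub_tendsto_zero {ι : Type*} {l : Filter ι} {x y : ι → H} {x₀ : H}
    (hx : ∀ h : H, Tendsto (fun i => ⟪h, x i⟫) l (𝓝 ⟪h, x₀⟫))
    (hxy : Tendsto (fun i => x i - y i) l (𝓝 0)) (h : H) :
    Tendsto (fun i => ⟪h, y i⟫) l (𝓝 ⟪h, x₀⟫) := by
  have h1 : Tendsto (fun i => ⟪h, x i - y i⟫) l (𝓝 0) := by
    simpa using (tendsto_const_nhds (x := h)).inner hxy
  simpa [inner_sub_right] using (hx h).sub h1

/-- Closed convex sets are closed under weak limits. -/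
theorem mem_of_tendsto_inner [CompleteSpace H] {C : Set H} (hne : C.Nonempty) (hcl : IsClosed C)
    (hcv : Convex ℝ C) {ι : Type*} {l : Filter ι} [l.NeBot] {x : ι → H} {x₀ : H}
    (hx : ∀ h : H, Tendsto (fun i => ⟪h, x i⟫) l (𝓝 ⟪h, x₀⟫)) (hxC : ∀ᶠ i in l, x i ∈ C) :
    x₀ ∈ C := by
  set p := metricProj C x₀ with hp
  have h1 : Tendsto (fun i => ⟪x₀ - p, x i - p⟫) l (𝓝 ⟪x₀ - p, x₀ - p⟫) := by
    simpa only [inner_sub_right] using (hx (x₀ - p)).sub_const ⟪x₀ - p, p⟫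
  have h2 : ⟪x₀ - p, x₀ - p⟫ ≤ 0 :=
    le_of_tendsto h1 (hxC.mono fun i hi => inner_sub_metricProj_le hcl hcv x₀ hi)
  have h3 : x₀ = p := sub_eq_zero.1 (real_inner_self_nonpos.1 h2)
  rw [h3]
  exact (metricProj_spec hne hcl hcv x₀).1

/-- Demiclosedness: weak limits of approximate fixed points of `P_C (I - lam f)` solve the
variational inequality, even if the step sizes `lam i` vary, as long as they stay away from `0`. -/
theorem mem_viSolutions_of_tendsto_inner [CompleteSpace H] {C : Set H} (hne : C.Nonempty)
    (hcl : IsClosed C) (hcv : Convex ℝ C) {f : H → H}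
    (hmono : ∀ x y, 0 ≤ ⟪f x - f y, x - y⟫) {K : ℝ≥0} (hf : LipschitzWith K f)
    {ι : Type*} {l : Filter ι} [l.NeBot] {x p ξ : ι → H} {x₀ : H} {lam : ι → ℝ} {c M : ℝ}
    (hc : 0 < c) (hlam : ∀ᶠ i in l, c < lam i) (hxM : ∀ i, ‖x i‖ ≤ M)
    (hx : ∀ h : H, Tendsto (fun i => ⟪h, x i⟫) l (𝓝 ⟪h, x₀⟫))
    (hp : ∀ᶠ i in l, p i = metricProj C (x i - lam i • f (x i) + ξ i))
    (hxp : Tendsto (fun i => x i - p i) l (𝓝 0)) (hξ : Tendsto ξ l (𝓝 0)) :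
    x₀ ∈ viSolutions f C := by
  rw [mem_viSolutions_iff_minty hcv hmono hf.continuous]
  refine ⟨mem_of_tendsto_inner hne hcl hcv (tendsto_inner_of_sub_tendsto_zero hx hxp)
    (hp.mono fun i hi => hi ▸ (metricProj_spec hne hcl hcv _).1), fun q hq => ?_⟩
  -- the projection inequality bounds `⟪f (x i), q - x i⟫` below by a null sequence
  have h1 : Tendsto (fun i => (lam i)⁻¹ * ⟪x i - p i + ξ i, q - p i⟫ - ⟪x i - p i, f (x i)⟫) l
      (𝓝 0) := by
    have hfb : ∀ i, ‖f (x i)‖ ≤ ‖f 0‖ + K * M := fun i => by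
      have h1 := hf.norm_sub_le (x i) 0
      have h2 := norm_le_norm_add_norm_sub' (f (x i)) (f 0)
      have h3 := mul_le_mul_of_nonneg_left (hxM i) K.coe_nonneg
      rw [sub_zero] at h1
      linarith
    have hqb : ∀ᶠ i in l, ‖q - p i‖ ≤ ‖q‖ + M + 1 := by
      have h1 : ∀ᶠ i in l, ‖x i - p i‖ ≤ 1 := hxp.norm.eventually_le_const (by simp)
      filter_upwards [h1] with i hi
      have h2 : q - p i = q - x i + (x i - p i) := by abel
      rw [h2]
      linarith [norm_add_le (q - x i) (x i - p i), norm_sub_le q (x i), hxM i]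
    have h2 := tendsto_inner_zero_of_bounded (y := fun i => q - p i)
      (show Tendsto (fun i => x i - p i + ξ i) l (𝓝 0) by simpa using hxp.add hξ) hqb
    have h3 : Tendsto (fun i => (lam i)⁻¹ * ⟪x i - p i + ξ i, q - p i⟫) l (𝓝 0) := by
      refine squeeze_zero_norm' (a := fun i => c⁻¹ * ‖⟪x i - p i + ξ i, q - p i⟫‖) ?_ ?_
      · filter_upwards [hlam] with i hi
        rw [norm_mul, norm_inv, Real.norm_of_nonneg (hc.trans hi).le]
        gcongr
      · simpa using h2.norm.const_mul c⁻¹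
    simpa using h3.sub (tendsto_inner_zero_of_bounded hxp (Eventually.of_forall hfb))
  have h2 : Tendsto (fun i => ⟪f q, q - x i⟫) l (𝓝 ⟪f q, q - x₀⟫) := by
    simpa [inner_sub_right] using (hx (f q)).const_sub ⟪f q, q⟫
  refine le_of_tendsto_of_tendsto h1 h2 ?_
  filter_upwards [hlam, hp] with i hi hpi
  have hpos : 0 < lam i := hc.trans hi
  have h3 := inner_sub_metricProj_le hcl hcv (x i - lam i • f (x i) + ξ i) hq
  rw [← hpi] at h3
  have h4 : x i - lam i • f (x i) + ξ i - p i = (x i - p i + ξ i) - lam i • f (x i) := by abel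
  rw [h4, inner_sub_left, inner_smul_left, RCLike.conj_to_real, sub_nonpos] at h3
  have h5 : (lam i)⁻¹ * ⟪x i - p i + ξ i, q - p i⟫ ≤ ⟪f (x i), q - p i⟫ := by
    rw [inv_mul_le_iff₀ hpos]
    exact h3
  have h6 : ⟪f (x i), q - x i⟫ = ⟪f (x i), q - p i⟫ - ⟪x i - p i, f (x i)⟫ := by
    rw [real_inner_comm (f (x i)) (x i - p i), ← inner_sub_right]
    congr 1
    abel
  have h7 := hmono q (x i)
  rw [inner_sub_left] at h7
  linarith

end WeakLimit

/-! ### Real recursions -/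

theorem exists_bound_of_recursion {s β : ℕ → ℝ} {K : ℝ} (hβ0 : ∀ᶠ n in atTop, 0 ≤ β n)
    (hβ1 : ∀ᶠ n in atTop, β n ≤ 1)
    (hs : ∀ᶠ n in atTop, s (n + 1) ≤ (1 - β n) * s n + β n * K) : ∃ M, ∀ n, s n ≤ M := by
  obtain ⟨N, hN⟩ := eventually_atTop.1 (hβ0.and (hβ1.and hs))
  have htail : ∀ n, N ≤ n → s n ≤ max (s N) K := by
    intro n hn
    induction n, hn using Nat.le_induction with
    | base => exact le_max_left _ _
    | succ n hn ih =>
      obtain ⟨h0, h1, h2⟩ := hN n hn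
      have h3 := mul_le_mul_of_nonneg_left ih (sub_nonneg.2 h1)
      have h4 := mul_le_mul_of_nonneg_left (le_max_right (s N) K) h0
      linarith
  have hbdd : BddAbove (Set.range s) := by
    refine (isBoundedUnder_of_eventually_le (f := atTop) (a := max (s N) K) ?_).bddAbove_range
    exact eventually_atTop.2 ⟨N, htail⟩
  obtain ⟨M, hM⟩ := hbdd
  exact ⟨M, fun n => hM ⟨n, rfl⟩⟩

theorem eventually_lt_of_contracting_recursion {s β : ℕ → ℝ} {ε ε' : ℝ} (hε : ε < ε')
    (hβ1 : ∀ᶠ n in atTop, β n ≤ 1)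
    (hβsum : Tendsto (fun N : ℕ => ∑ n ∈ Finset.range N, β n) atTop atTop)
    (hs : ∀ᶠ n in atTop, s (n + 1) ≤ (1 - β n) * s n + β n * ε) :
    ∀ᶠ n in atTop, s n < ε' := by
  obtain ⟨N, hN⟩ := eventually_atTop.1 (hβ1.and hs)
  set B : ℕ → ℝ := fun n => ∑ k ∈ Finset.range n, β k with hB
  have htail : ∀ n, N ≤ n → s n - ε ≤ |s N - ε| * Real.exp (B N - B n) := by
    intro n hn
    induction n, hn using Nat.le_induction with
    | base => simpa using le_abs_self (s N - ε)
    | succ n hn ih =>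
      obtain ⟨h1, h2⟩ := hN n hn
      have h3 : B N - B (n + 1) = -β n + (B N - B n) := by
        simp only [hB, Finset.sum_range_succ]
        ring
      calc s (n + 1) - ε ≤ (1 - β n) * (s n - ε) := by linarith
        _ ≤ (1 - β n) * (|s N - ε| * Real.exp (B N - B n)) :=
          mul_le_mul_of_nonneg_left ih (sub_nonneg.2 h1)
        _ ≤ Real.exp (-β n) * (|s N - ε| * Real.exp (B N - B n)) := by
          gcongr
          exact Real.one_sub_le_exp_neg _
        _ = |s N - ε| * Real.exp (B N - B (n + 1)) := by
          rw [h3, Real.exp_add]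
          ring
  have hlim : Tendsto (fun n => |s N - ε| * Real.exp (B N - B n)) atTop (𝓝 0) := by
    have h1 : Tendsto (fun n => B N - B n) atTop atBot := by
      simpa only [sub_eq_add_neg, Function.comp_def] using
        tendsto_atBot_add_const_left atTop (B N) (tendsto_neg_atTop_atBot.comp hβsum)
    simpa using (Real.tendsto_exp_atBot.comp h1).const_mul |s N - ε|
  filter_upwards [hlim.eventually_lt_const (sub_pos.2 hε), eventually_ge_atTop N] with n h1 h2
  linarith [htail n h2]

/-- A recursion with a gain term `g`. The error `e` has to be asymptotically nonpositive only along
those indices where `g` tends to `0`: wherever `g n > δ`, the gain outweighs the error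
`β n * e n`. -/
theorem tendsto_zero_of_recursion_with_gain {s g e β : ℕ → ℝ} {M : ℝ} (hs0 : ∀ n, 0 ≤ s n)
    (hg0 : ∀ n, 0 ≤ g n) (hβ0 : ∀ᶠ n in atTop, 0 ≤ β n) (hβ : Tendsto β atTop (𝓝 0))
    (hβsum : Tendsto (fun N : ℕ => ∑ n ∈ Finset.range N, β n) atTop atTop)
    (heM : ∀ᶠ n in atTop, e n ≤ M)
    (hs : ∀ᶠ n in atTop, s (n + 1) ≤ (1 - β n) * s n - g n + β n * e n)
    (he : ∀ ε > 0, ∀ᶠ n in atTop ⊓ comap g (𝓝 0), e n ≤ ε) :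
    Tendsto s atTop (𝓝 0) := by
  have hβ1 : ∀ᶠ n in atTop, β n ≤ 1 := hβ.eventually_le_const one_pos
  rw [tendsto_order]
  refine ⟨fun a ha => Eventually.of_forall fun n => ha.trans_le (hs0 n), fun ε' hε' => ?_⟩
  have hε : 0 < ε' / 2 := half_pos hε'
  refine eventually_lt_of_contracting_recursion (half_lt_self hε') hβ1 hβsum ?_
  obtain ⟨δ, hδ, hδe⟩ : ∃ δ > 0, ∀ᶠ n in atTop, g n < δ → e n ≤ ε' / 2 := by
    obtain ⟨p, hp, q, hq, hpq⟩ := eventually_inf.1 (he _ hε)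
    obtain ⟨t, ht, htq⟩ := mem_comap.1 hq
    obtain ⟨δ, hδ, hδt⟩ := Metric.mem_nhds_iff.1 ht
    refine ⟨δ, hδ, Filter.mem_of_superset hp fun n hn hgn => hpq n ⟨hn, htq (hδt ?_)⟩⟩
    simpa [abs_of_nonneg (hg0 n)] using hgn
  have hβM : ∀ᶠ n in atTop, β n * M < δ := by
    have : Tendsto (fun n => β n * M) atTop (𝓝 0) := by simpa using hβ.mul_const M
    exact this.eventually_lt_const hδ
  filter_upwards [hs, hβ0, hδe, hβM, heM] with n h1 h2 h3 h4 h5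
  rcases lt_or_ge (g n) δ with h | h
  · have := mul_le_mul_of_nonneg_left (h3 h) h2
    linarith [hg0 n]
  · have h6 := mul_le_mul_of_nonneg_left h5 h2
    have h7 := mul_nonneg h2 hε.le
    linarith

/-! ### Strong convergence of regularized contractive recursions -/

section Recursion

variable {H : Type*} [NormedAddCommGroup H] [InnerProductSpace ℝ H]

theorem norm_sub_sub_smul_sq_le {d η φ : H} {G γ L t : ℝ} (hG : 0 < G)
    (hη : (1 + G) * ‖η‖ ^ 2 ≤ 2 * ⟪η, d⟫) (hφL : ‖φ‖ ≤ L * ‖d‖) (hφγ : γ * ‖d‖ ^ 2 ≤ ⟪φ, d⟫)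
    (ht : 0 ≤ t) (htγ : t * ((2 / G + 1) * L ^ 2) ≤ γ) :
    ‖d - η - t • φ‖ ^ 2 ≤ (1 - t * γ) * ‖d‖ ^ 2 - G / 2 * ‖η‖ ^ 2 := by
  have h1 : ‖d - η - t • φ‖ ^ 2 = ‖d‖ ^ 2 - 2 * ⟪η, d⟫ + ‖η‖ ^ 2 - 2 * t * ⟪φ, d⟫
      + 2 * t * ⟪φ, η⟫ + t ^ 2 * ‖φ‖ ^ 2 := by
    rw [norm_sub_sq_real, norm_sub_sq_real, inner_smul_right, inner_sub_left, norm_smul, mul_pow,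
      Real.norm_eq_abs, sq_abs, real_inner_comm η d, real_inner_comm φ d, real_inner_comm φ η]
    ring
  -- Young's inequality absorbs the cross term into the gain `G ‖η‖²`
  have h2 : 2 * t * ⟪φ, η⟫ ≤ G / 2 * ‖η‖ ^ 2 + 2 / G * (t ^ 2 * ‖φ‖ ^ 2) := by
    have h3 : t * ⟪φ, η⟫ ≤ t * (‖φ‖ * ‖η‖) :=
      mul_le_mul_of_nonneg_left (real_inner_le_norm _ _) ht
    have h4 : G / 2 * ‖η‖ ^ 2 + 2 / G * (t ^ 2 * ‖φ‖ ^ 2) - 2 * (t * (‖φ‖ * ‖η‖))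
        = 2 / G * (t * ‖φ‖ - G / 2 * ‖η‖) ^ 2 := by
      field_simp
      ring
    have h5 : 0 ≤ 2 / G * (t * ‖φ‖ - G / 2 * ‖η‖) ^ 2 := by positivity
    linarith
  have h3 : ‖φ‖ ^ 2 ≤ L ^ 2 * ‖d‖ ^ 2 := by
    rw [← mul_pow]
    exact pow_le_pow_left₀ (norm_nonneg _) hφL 2
  have h4 : (2 / G + 1) * (t ^ 2 * ‖φ‖ ^ 2) ≤ t * γ * ‖d‖ ^ 2 := by
    calc (2 / G + 1) * (t ^ 2 * ‖φ‖ ^ 2) ≤ (2 / G + 1) * (t ^ 2 * (L ^ 2 * ‖d‖ ^ 2)) := by gcongr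
      _ = t * (t * ((2 / G + 1) * L ^ 2)) * ‖d‖ ^ 2 := by ring
      _ ≤ t * γ * ‖d‖ ^ 2 := by gcongr
  have h5 := mul_le_mul_of_nonneg_left hφγ ht
  linarith

/-- Strong convergence from weak information. For a regularized step `z ↦ P (T z - t F z)` with
`P (T u) = u`, the vector `η n` stands for the increment of `I - T` between `u` and `z n`, and `r n`
for that of `I - P` between `T u` and the projected point. The squared distance to `u` decreases by
multiples of `‖η n‖ ^ 2` and `‖r n‖ ^ 2`, and the regularization term `t n • F` contracts it up to
an error governed by `-⟪F u, z n - u⟫`; it therefore suffices to control the weak limits of `z`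
along which `η` and `r` tend to `0`. -/
theorem tendsto_of_regularized_recursion [CompleteSpace H] {F : H → H} {γ : ℝ}
    (hF : IsStronglyMonotone γ F) {L : ℝ≥0} (hL : LipschitzWith L F) {u : H} {z η r : ℕ → H}
    {t : ℕ → ℝ} {G : ℝ} (hG : 0 < G) (ht0 : ∀ᶠ n in atTop, 0 ≤ t n) (ht : Tendsto t atTop (𝓝 0))
    (htsum : Tendsto (fun N : ℕ => ∑ n ∈ Finset.range N, t n) atTop atTop)
    (hstep : ∀ᶠ n in atTop,
      ‖z (n + 1) - u‖ ^ 2 + ‖r n‖ ^ 2 ≤ ‖z n - u - η n - t n • F (z n)‖ ^ 2)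
    (hη : ∀ᶠ n in atTop, (1 + G) * ‖η n‖ ^ 2 ≤ 2 * ⟪η n, z n - u⟫)
    (hweak : ∀ M : ℝ, (∀ n, ‖z n‖ ≤ M) → ∀ U : Ultrafilter ℕ, (U : Filter ℕ) ≤ atTop →
      Tendsto η U (𝓝 0) → Tendsto r U (𝓝 0) →
      ∀ z₀ : H, (∀ h : H, Tendsto (fun n => ⟪h, z n⟫) U (𝓝 ⟪h, z₀⟫)) → 0 ≤ ⟪F u, z₀ - u⟫) :
    Tendsto z atTop (𝓝 u) := by
  have hγ := hF.1
  have hφL : ∀ n, ‖F (z n) - F u‖ ≤ L * ‖z n - u‖ := fun n => hL.norm_sub_le _ _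
  set q : ℕ → H := fun n => z n - u - η n - t n • F (z n) with hq
  have hqv : ∀ n, q n = (z n - u - η n - t n • (F (z n) - F u)) - t n • F u := fun n => by
    simp only [hq, smul_sub]
    abel
  have hcontr : ∀ᶠ n in atTop, ‖z n - u - η n - t n • (F (z n) - F u)‖ ^ 2
      ≤ (1 - t n * γ) * ‖z n - u‖ ^ 2 - G / 2 * ‖η n‖ ^ 2 := by
    have h1 : Tendsto (fun n => t n * ((2 / G + 1) * (L : ℝ) ^ 2)) atTop (𝓝 0) := by
      simpa using ht.mul_const ((2 / G + 1) * (L : ℝ) ^ 2)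
    filter_upwards [ht0, hη, h1.eventually_le_const hγ] with n h0 h2 h3
    exact norm_sub_sub_smul_sq_le hG h2 (hφL n) (hF.2 _ _) h0 h3
  have hqnorm : ∀ᶠ n in atTop, ‖q n‖ ≤ ‖z n - u‖ + t n * ‖F u‖ := by
    filter_upwards [hcontr, ht0] with n h1 h0
    have h2 : ‖z n - u - η n - t n • (F (z n) - F u)‖ ≤ ‖z n - u‖ := by
      refine le_of_sq_le_sq (h1.trans ?_) (norm_nonneg _)
      have h3 : 0 ≤ t n * γ * ‖z n - u‖ ^ 2 := by positivity
      have h4 : 0 ≤ G / 2 * ‖η n‖ ^ 2 := by positivity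
      linarith
    rw [hqv]
    refine (norm_sub_le _ _).trans ?_
    rw [norm_smul, Real.norm_of_nonneg h0]
    gcongr
  have henergy : ∀ᶠ n in atTop, ‖z (n + 1) - u‖ ^ 2 ≤ (1 - t n * γ) * ‖z n - u‖ ^ 2
      - (G / 2 * ‖η n‖ ^ 2 + ‖r n‖ ^ 2) - 2 * t n * ⟪F u, q n⟫ := by
    filter_upwards [hcontr, hstep] with n h1 h2
    have h3 : ‖z n - u - η n - t n • (F (z n) - F u)‖ ^ 2
        = ‖q n‖ ^ 2 + 2 * t n * ⟪F u, q n⟫ + ‖t n • F u‖ ^ 2 := by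
      have h4 : z n - u - η n - t n • (F (z n) - F u) = q n + t n • F u := by
        rw [hqv]
        abel
      rw [h4, norm_add_sq_real, inner_smul_right, real_inner_comm (F u) (q n)]
      ring
    have h5 := sq_nonneg ‖t n • F u‖
    linarith
  have ht1 : ∀ᶠ n in atTop, t n ≤ 1 := ht.eventually_le_const one_pos
  have hinner : ∀ n, -⟪F u, q n⟫ ≤ ‖F u‖ * ‖q n‖ := fun n =>
    (neg_le_abs _).trans (abs_real_inner_le_norm _ _)
  -- half of the contraction absorbs the part of the error that is linear in `‖z n - u‖`
  obtain ⟨M₁, hM₁⟩ : ∃ M, ∀ n, ‖z n - u‖ ^ 2 ≤ M := by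
    have hγt : Tendsto (fun n => t n * γ / 2) atTop (𝓝 0) := by
      simpa using (ht.mul_const γ).div_const 2
    refine exists_bound_of_recursion (β := fun n => t n * γ / 2)
      (K := 2 / γ * ((2 / γ + 2) * ‖F u‖ ^ 2)) ?_ (hγt.eventually_le_const one_pos) ?_
    · filter_upwards [ht0] with n h0
      positivity
    · filter_upwards [henergy, hqnorm, ht0, ht1] with n h1 h2 h0 h3
      have h4 : -⟪F u, q n⟫ ≤ ‖F u‖ * ‖z n - u‖ + ‖F u‖ ^ 2 := by
        have h5 := mul_le_mul_of_nonneg_left h2 (norm_nonneg (F u))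
        have h6 : t n * ‖F u‖ ^ 2 ≤ 1 * ‖F u‖ ^ 2 := by gcongr
        linarith [hinner n]
      have h5 : 2 * (‖F u‖ * ‖z n - u‖) ≤ γ / 2 * ‖z n - u‖ ^ 2 + 2 / γ * ‖F u‖ ^ 2 := by
        have h6 : γ / 2 * ‖z n - u‖ ^ 2 + 2 / γ * ‖F u‖ ^ 2 - 2 * (‖F u‖ * ‖z n - u‖)
            = 2 / γ * (‖F u‖ - γ / 2 * ‖z n - u‖) ^ 2 := by
          field_simp
          ring
        have h7 : 0 ≤ 2 / γ * (‖F u‖ - γ / 2 * ‖z n - u‖) ^ 2 := by positivity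
        linarith
      have h6 : -(2 * t n * ⟪F u, q n⟫)
          ≤ t n * (γ / 2 * ‖z n - u‖ ^ 2 + (2 / γ + 2) * ‖F u‖ ^ 2) := by
        have h7 : 2 * -⟪F u, q n⟫ ≤ γ / 2 * ‖z n - u‖ ^ 2 + (2 / γ + 2) * ‖F u‖ ^ 2 := by
          linarith
        have h8 := mul_le_mul_of_nonneg_left h7 h0
        linarith
      have h7 : t n * γ / 2 * (2 / γ * ((2 / γ + 2) * ‖F u‖ ^ 2))
          = t n * ((2 / γ + 2) * ‖F u‖ ^ 2) := by
        field_simp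
      have h8 : 0 ≤ G / 2 * ‖η n‖ ^ 2 + ‖r n‖ ^ 2 := by positivity
      rw [h7]
      linarith
  have hd : ∀ n, ‖z n - u‖ ≤ √M₁ := fun n => Real.le_sqrt_of_sq_le (hM₁ n)
  have hzM : ∀ n, ‖z n‖ ≤ ‖u‖ + √M₁ := fun n =>
    (norm_le_norm_add_norm_sub' (z n) u).trans (by gcongr; exact hd n)
  have hFz : ∀ n, ‖F (z n)‖ ≤ ‖F u‖ + L * √M₁ := fun n =>
    (norm_le_norm_add_norm_sub' (F (z n)) (F u)).trans
      (by gcongr; exact (hφL n).trans (mul_le_mul_of_nonneg_left (hd n) L.coe_nonneg))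
  have hs : Tendsto (fun n => ‖z n - u‖ ^ 2) atTop (𝓝 0) := by
    refine tendsto_zero_of_recursion_with_gain (β := fun n => t n * γ)
      (g := fun n => G / 2 * ‖η n‖ ^ 2 + ‖r n‖ ^ 2) (e := fun n => 2 / γ * -⟪F u, q n⟫)
      (M := 2 / γ * (‖F u‖ * (√M₁ + 1 * ‖F u‖))) (fun n => sq_nonneg _) (fun n => by positivity)
      ?_ ?_ ?_ ?_ ?_ ?_
    · filter_upwards [ht0] with n h0
      positivity
    · simpa using ht.mul_const γ
    · simpa only [Finset.sum_mul] using htsum.atTop_mul_const hγ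
    · filter_upwards [hqnorm, ht1] with n h1 h2
      refine mul_le_mul_of_nonneg_left ((hinner n).trans ?_) (by positivity)
      refine mul_le_mul_of_nonneg_left (h1.trans ?_) (norm_nonneg _)
      gcongr
      exact hd n
    · filter_upwards [henergy] with n h1
      refine h1.trans (le_of_eq ?_)
      field_simp
      ring
    · intro ε hε
      refine Filter.mem_iff_ultrafilter.2 fun U hU => ?_
      have hUtop : (U : Filter ℕ) ≤ atTop := hU.trans inf_le_left
      have hg : Tendsto (fun n => G / 2 * ‖η n‖ ^ 2 + ‖r n‖ ^ 2) U (𝓝 0) :=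
        tendsto_comap.mono_left (hU.trans inf_le_right)
      have hη0 : Tendsto η U (𝓝 0) := by
        have h1 : Tendsto (fun n => G / 2 * ‖η n‖ ^ 2) U (𝓝 0) :=
          squeeze_zero (fun n => by positivity) (fun n => le_add_of_nonneg_right (sq_nonneg _)) hg
        have h2 : Tendsto (fun n => ‖η n‖ ^ 2) U (𝓝 0) := by
          have h3 := h1.const_mul (2 / G)
          rw [mul_zero] at h3
          refine h3.congr fun n => ?_
          field_simp
        rw [tendsto_zero_iff_norm_tendsto_zero]
        simpa using h2.sqrt
      have hr0 : Tendsto r U (𝓝 0) := by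
        have h1 : Tendsto (fun n => ‖r n‖ ^ 2) U (𝓝 0) :=
          squeeze_zero (fun n => by positivity)
            (fun n => le_add_of_nonneg_left (by positivity)) hg
        rw [tendsto_zero_iff_norm_tendsto_zero]
        simpa using h1.sqrt
      obtain ⟨z₀, hz₀⟩ := U.exists_tendsto_inner hzM
      have h0 := hweak _ hzM U hUtop hη0 hr0 z₀ hz₀
      have htF : Tendsto (fun n => t n • F (z n)) U (𝓝 0) :=
        (ht.mono_left hUtop).zero_smul_isBoundedUnder_le
          (isBoundedUnder_of ⟨_, hFz⟩)
      have hzq : Tendsto (fun n => z n - (q n + u)) U (𝓝 0) := by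
        have h1 := hη0.add htF
        rw [add_zero] at h1
        refine h1.congr fun n => ?_
        simp only [hq]
        abel
      have h1 := tendsto_inner_of_sub_tendsto_zero hz₀ hzq (F u)
      have h2 : Tendsto (fun n => 2 / γ * -⟪F u, q n⟫) U (𝓝 (2 / γ * -⟪F u, z₀ - u⟫)) := by
        have h3 := h1.sub_const ⟪F u, u⟫
        simp only [← inner_sub_right, add_sub_cancel_right] at h3
        exact (h3.neg).const_mul _
      refine h2.eventually_le_const (lt_of_le_of_lt ?_ hε)
      exact mul_nonpos_of_nonneg_of_nonpos (by positivity) (neg_nonpos.2 h0)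
  rw [tendsto_iff_norm_sub_tendsto_zero]
  simpa using hs.sqrt

end Recursion

/-! ### The split variational inequality problem -/

section Split

variable {H₁ H₂ : Type*} [NormedAddCommGroup H₁] [InnerProductSpace ℝ H₁]
  [NormedAddCommGroup H₂] [InnerProductSpace ℝ H₂]

theorem isClosed_svipSolutions {f₁ : H₁ → H₁} {f₂ : H₂ → H₂} {C : Set H₁} {Q : Set H₂}
    {A : H₁ →L[ℝ] H₂} {τ₁ τ₂ : ℝ} (hCcl : IsClosed C) (hCcv : Convex ℝ C) (hQcl : IsClosed Q)
    (hQcv : Convex ℝ Q) (hf₁ : IsInverseStronglyMonotone τ₁ f₁)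
    (hf₂ : IsInverseStronglyMonotone τ₂ f₂) : IsClosed (svipSolutions f₁ f₂ C Q A) :=
  (isClosed_viSolutions hCcl hCcv hf₁.inner_nonneg hf₁.lipschitzWith.continuous).inter
    ((isClosed_viSolutions hQcl hQcv hf₂.inner_nonneg hf₂.lipschitzWith.continuous).preimage
      A.continuous)

theorem convex_svipSolutions {f₁ : H₁ → H₁} {f₂ : H₂ → H₂} {C : Set H₁} {Q : Set H₂}
    {A : H₁ →L[ℝ] H₂} {τ₁ τ₂ : ℝ} (hCcv : Convex ℝ C) (hQcv : Convex ℝ Q)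
    (hf₁ : IsInverseStronglyMonotone τ₁ f₁) (hf₂ : IsInverseStronglyMonotone τ₂ f₂) :
    Convex ℝ (svipSolutions f₁ f₂ C Q A) :=
  (convex_viSolutions hCcv hf₁.inner_nonneg hf₁.lipschitzWith.continuous).inter
    ((convex_viSolutions hQcv hf₂.inner_nonneg hf₂.lipschitzWith.continuous).linear_preimage
      A.toLinearMap)

/-- The residual `(I - P_Q (I - lam f)) y`, which vanishes when `y` solves the variational
inequality of `f` on `Q`. -/
noncomputable def viResidual {H : Type*} [NormedAddCommGroup H] [InnerProductSpace ℝ H]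
    (f : H → H) (Q : Set H) (lam : ℝ) (y : H) : H :=
  y - metricProj Q (y - lam • f y)

/-- If `d` and the increments `a` (of `f₁`) and `b` (of the residual of `f₂`) satisfy their
monotonicity inequalities, the combined increment `lam (a + A* b)` does so with the constant
`ρ / 4`. -/
theorem norm_smul_add_adjoint_sq_le [CompleteSpace H₁] [CompleteSpace H₂] (A : H₁ →L[ℝ] H₂)
    {d a : H₁} {b : H₂} {τ lam ρ : ℝ} (hlam : 0 ≤ lam) (hρ : 0 ≤ ρ) (hτ : lam * ρ ≤ τ)
    (hA : lam * ρ * ‖A‖ ^ 2 ≤ 1) (ha : τ * ‖a‖ ^ 2 ≤ ⟪a, d⟫) (hb : 1 / 2 * ‖b‖ ^ 2 ≤ ⟪b, A d⟫) :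
    ρ / 2 * ‖lam • (a + ContinuousLinearMap.adjoint A b)‖ ^ 2
      ≤ 2 * ⟪lam • (a + ContinuousLinearMap.adjoint A b), d⟫ := by
  set e := a + ContinuousLinearMap.adjoint A b with he
  have h1 : ⟪e, d⟫ = ⟪a, d⟫ + ⟪b, A d⟫ := by
    rw [he, inner_add_left, ContinuousLinearMap.adjoint_inner_left]
  have h2 : ‖ContinuousLinearMap.adjoint A b‖ ^ 2 ≤ ‖A‖ ^ 2 * ‖b‖ ^ 2 := by
    rw [← mul_pow]
    refine pow_le_pow_left₀ (norm_nonneg _) ?_ 2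
    simpa using (ContinuousLinearMap.adjoint A).le_opNorm b
  have h3 : ‖e‖ ^ 2 ≤ 2 * (‖a‖ ^ 2 + ‖A‖ ^ 2 * ‖b‖ ^ 2) := by
    have h4 := parallelogram_law_with_norm ℝ a (ContinuousLinearMap.adjoint A b)
    nlinarith [mul_self_nonneg ‖a - ContinuousLinearMap.adjoint A b‖]
  have h5 : lam * ρ * ‖e‖ ^ 2 ≤ 4 * ⟪e, d⟫ := by
    have h6 : 0 ≤ lam * ρ := mul_nonneg hlam hρ
    have h7 := mul_le_mul_of_nonneg_left h3 h6
    have h8 := mul_le_mul_of_nonneg_right hτ (sq_nonneg ‖a‖)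
    have h9 := mul_le_mul_of_nonneg_right hA (sq_nonneg ‖b‖)
    have h10 : 0 ≤ τ * ‖a‖ ^ 2 := mul_nonneg (h6.trans hτ) (sq_nonneg _)
    linarith
  rw [norm_smul, mul_pow, Real.norm_eq_abs, sq_abs, inner_smul_left, RCLike.conj_to_real]
  have h6 := mul_le_mul_of_nonneg_left h5 hlam
  linarith

end Split

theorem mainTheorem7
    {H₁ : Type*} [NormedAddCommGroup H₁] [InnerProductSpace ℝ H₁] [CompleteSpace H₁]
    {H₂ : Type*} [NormedAddCommGroup H₂] [InnerProductSpace ℝ H₂] [CompleteSpace H₂]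
    (C : Set H₁) (hCne : C.Nonempty) (hCcl : IsClosed C) (hCcv : Convex ℝ C)
    (Q : Set H₂) (hQne : Q.Nonempty) (hQcl : IsClosed Q) (hQcv : Convex ℝ Q)
    (A : H₁ →L[ℝ] H₂)
    (f₁ : H₁ → H₁) (τ₁ : ℝ) (hf₁ : IsInverseStronglyMonotone τ₁ f₁)
    (f₂ : H₂ → H₂) (τ₂ : ℝ) (hf₂ : IsInverseStronglyMonotone τ₂ f₂)
    (F : H₁ → H₁) (γ : ℝ) (hFmono : IsStronglyMonotone γ F)
    (L : ℝ≥0) (hFlip : LipschitzWith L F)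
    (hΩ : (svipSolutions f₁ f₂ C Q A).Nonempty)
    (α lam : ℕ → ℝ)
    (hα : ∀ n, 1 ≤ n → α n ∈ Set.Ioo (0 : ℝ) 1)
    (hα_lim : Tendsto α atTop (𝓝 0))
    (hα_sum : Tendsto (fun N : ℕ => ∑ n ∈ Finset.Icc 1 N, α n) atTop atTop)
    (hα_diff : Tendsto (fun n : ℕ => |α (n + 1) - α n| / α n ^ 2) atTop (𝓝 0))
    (c ρ : ℝ) (hc : 0 < c) (hρ : 2 < ρ)
    (hlam_lower : ∀ n, 1 ≤ n → c < lam n)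
    (hlam_tau : ∀ n, 1 ≤ n → lam n < 1 / ρ * min τ₁ τ₂)
    -- `lam n < (1 / ρ) * (1 / ‖A‖ ^ 2)`, read with `1 / 0 = +∞` when `A = 0`
    (hlam_norm : ∀ n, 1 ≤ n → lam n * ‖A‖ ^ 2 < 1 / ρ)
    (z : ℕ → H₁)
    (hz : ∀ n, 1 ≤ n → z (n + 1) = svipStep f₁ f₂ F C Q A (lam n) (α n) (z n)) :
    ∃ u ∈ svipSolutions f₁ f₂ C Q A,
      (∀ x ∈ svipSolutions f₁ f₂ C Q A, 0 ≤ ⟪F u, x - u⟫) ∧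
      (∀ v ∈ svipSolutions f₁ f₂ C Q A,
        (∀ x ∈ svipSolutions f₁ f₂ C Q A, 0 ≤ ⟪F v, x - v⟫) → v = u) ∧
      Tendsto z atTop (𝓝 u) := by
  obtain ⟨u, hu⟩ := exists_mem_viSolutions hΩ (isClosed_svipSolutions hCcl hCcv hQcl hQcv hf₁ hf₂)
    (convex_svipSolutions hCcv hQcv hf₁ hf₂) hFmono hFlip
  refine ⟨u, hu.1, hu.2, fun v hv hv' => viSolutions_unique hFmono hu ⟨hv, hv'⟩, ?_⟩
  have hρ0 : 0 < ρ := two_pos.trans hρ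
  have hlam0 : ∀ n, 1 ≤ n → 0 < lam n := fun n hn => hc.trans (hlam_lower n hn)
  have hlamρ : ∀ n, 1 ≤ n → lam n * ρ ≤ min τ₁ τ₂ := fun n hn => by
    have h1 := hlam_tau n hn
    rw [one_div_mul_eq_div, lt_div_iff₀ hρ0] at h1
    exact h1.le
  have hlamA : ∀ n, 1 ≤ n → lam n * ρ * ‖A‖ ^ 2 ≤ 1 := fun n hn => by
    have h1 := hlam_norm n hn
    rw [lt_div_iff₀ hρ0] at h1
    linarith
  have hlamM : ∀ n, 1 ≤ n → lam n ≤ τ₁ := fun n hn => by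
    have h1 := (hlamρ n hn).trans (min_le_left _ _)
    nlinarith [hlam0 n hn]
  -- increments, relative to `u`, of `f₁` and of the residual of `f₂`, which vanishes at `A u`
  set a : ℕ → H₁ := fun n => f₁ (z n) - f₁ u with ha
  set b : ℕ → H₂ := fun n => viResidual f₂ Q (lam n) (A (z n)) with hb
  have ha_mono : ∀ n, τ₁ * ‖a n‖ ^ 2 ≤ ⟪a n, z n - u⟫ := fun n => hf₁.2 _ _
  have hb_mono : ∀ n, 1 ≤ n → 1 / 2 * ‖b n‖ ^ 2 ≤ ⟪b n, A (z n - u)⟫ := fun n hn => by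
    have h1 : lam n ≤ 2 * τ₂ := by
      have h2 := (hlamρ n hn).trans (min_le_right _ _)
      nlinarith [hlam0 n hn]
    have h2 := norm_sub_metricProj_sq_le hQne hQcl hQcv hf₂ (hlam0 n hn).le h1 (A (z n)) (A u)
    rwa [metricProj_eq_of_mem_viSolutions hQcl hQcv hu.1.2 (hlam0 n hn).le, sub_self,
      sub_zero, ← map_sub] at h2
  set η : ℕ → H₁ := fun n => lam n • (a n + ContinuousLinearMap.adjoint A (b n)) with hη
  set t : ℕ → ℝ := fun n => lam n * α n with ht
  set r : ℕ → H₁ := fun n => (z n - u - η n - t n • F (z n)) - (z (n + 1) - u) with hr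
  have hzP : ∀ n, 1 ≤ n → z (n + 1) = metricProj C (z n - lam n • f₁ (z n)
      + -(lam n • ContinuousLinearMap.adjoint A (b n) + t n • F (z n))) := fun n hn => by
    rw [hz n hn, svipStep]
    congr 1
    simp only [hb, ht, viResidual]
    abel
  have hη_mono : ∀ n, 1 ≤ n → ρ / 2 * ‖η n‖ ^ 2 ≤ 2 * ⟪η n, z n - u⟫ := fun n hn =>
    norm_smul_add_adjoint_sq_le A (hlam0 n hn).le hρ0.le
      ((hlamρ n hn).trans (min_le_left _ _)) (hlamA n hn) (ha_mono n) (hb_mono n hn)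
  have htlim : Tendsto t atTop (𝓝 0) := by
    have h1 : Tendsto (fun n => τ₁ * α n) atTop (𝓝 0) := by simpa using hα_lim.const_mul τ₁
    refine squeeze_zero' ?_ ?_ h1
    · filter_upwards [eventually_ge_atTop 1] with n hn
      exact mul_nonneg (hlam0 n hn).le (hα n hn).1.le
    · filter_upwards [eventually_ge_atTop 1] with n hn
      exact mul_le_mul_of_nonneg_right (hlamM n hn) (hα n hn).1.le
  have htsum : Tendsto (fun N : ℕ => ∑ n ∈ Finset.range N, t n) atTop atTop := by
    rw [← tendsto_add_atTop_iff_nat 1]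
    refine tendsto_atTop_mono (fun N => ?_)
      (tendsto_atTop_add_const_left _ (t 0) (hα_sum.const_mul_atTop hc))
    rw [Finset.sum_range_eq_add_Ico _ N.succ_pos, Finset.mul_sum]
    refine add_le_add_right (Finset.sum_le_sum fun n hn => ?_) _
    have hn1 : 1 ≤ n := (Finset.mem_Icc.1 hn).1
    exact mul_le_mul_of_nonneg_right (hlam_lower n hn1).le (hα n hn1).1.le
  refine tendsto_of_regularized_recursion hFmono hFlip (z := z) (η := η) (r := r) (t := t)
    (G := ρ / 2 - 1) (by linarith) ?_ htlim htsum ?_ ?_ ?_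
  · filter_upwards [eventually_ge_atTop 1] with n hn
    exact mul_nonneg (hlam0 n hn).le (hα n hn).1.le
  · -- firm nonexpansiveness of `P_C`, applied with `u = P_C (u - lam f₁ u)`
    filter_upwards [eventually_ge_atTop 1] with n hn
    have h1 := norm_metricProj_sub_sq_add_le hCne hCcl hCcv (z n - lam n • f₁ (z n)
      + -(lam n • ContinuousLinearMap.adjoint A (b n) + t n • F (z n))) (u - lam n • f₁ u)
    rw [← hzP n hn, metricProj_eq_of_mem_viSolutions hCcl hCcv hu.1.1 (hlam0 n hn).le] at h1
    have h2 : z n - lam n • f₁ (z n) + -(lam n • ContinuousLinearMap.adjoint A (b n)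
        + t n • F (z n)) - (u - lam n • f₁ u) = z n - u - η n - t n • F (z n) := by
      simp only [hη, ha, smul_add, smul_sub]
      abel
    rwa [h2] at h1
  · filter_upwards [eventually_ge_atTop 1] with n hn
    rw [add_sub_cancel]
    exact hη_mono n hn
  · intro M hM U hU hη0 hr0 z₀ hz₀
    have hU1 : ∀ᶠ n in (U : Filter ℕ), 1 ≤ n := hU (eventually_ge_atTop 1)
    have hUc : ∀ᶠ n in (U : Filter ℕ), c < lam n := hU1.mono hlam_lower
    have hFb : ∀ n, ‖F (z n)‖ ≤ ‖F 0‖ + L * M := fun n => by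
      have h1 := hFlip.norm_sub_le (z n) 0
      have h2 := norm_le_norm_add_norm_sub' (F (z n)) (F 0)
      have h3 := mul_le_mul_of_nonneg_left (hM n) L.coe_nonneg
      rw [sub_zero] at h1
      linarith
    have htF : Tendsto (fun n => t n • F (z n)) U (𝓝 0) :=
      (htlim.mono_left hU).zero_smul_isBoundedUnder_le (isBoundedUnder_of ⟨_, hFb⟩)
    -- since `⟪η n, z n - u⟫` dominates `c / 2 * ‖b n‖ ^ 2`, the residuals of `f₂` tend to `0`
    have hb0 : Tendsto b U (𝓝 0) := by
      have h1 : Tendsto (fun n => ⟪η n, z n - u⟫) U (𝓝 0) :=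
        tendsto_inner_zero_of_bounded (M := M + ‖u‖) hη0 (Eventually.of_forall fun n =>
          (norm_sub_le _ _).trans (by linarith [hM n]))
      have h2 : Tendsto (fun n => ‖b n‖ ^ 2) U (𝓝 0) := by
        have h3 : Tendsto (fun n => 2 / c * ⟪η n, z n - u⟫) U (𝓝 0) := by
          simpa using h1.const_mul (2 / c)
        refine squeeze_zero' (Eventually.of_forall fun n => sq_nonneg _) ?_ h3
        filter_upwards [hU1] with n hn
        have h4 : ⟪η n, z n - u⟫ = lam n * (⟪a n, z n - u⟫ + ⟪b n, A (z n - u)⟫) := by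
          simp only [hη]
          rw [inner_smul_left, RCLike.conj_to_real, inner_add_left,
            ContinuousLinearMap.adjoint_inner_left]
        have h5 : 1 / 2 * ‖b n‖ ^ 2 ≤ ⟪a n, z n - u⟫ + ⟪b n, A (z n - u)⟫ := by
          have := mul_nonneg hf₁.1.le (sq_nonneg ‖a n‖)
          linarith [ha_mono n, hb_mono n hn]
        have h6 : c * (1 / 2 * ‖b n‖ ^ 2) ≤ ⟪η n, z n - u⟫ := by
          rw [h4]
          exact mul_le_mul (hlam_lower n hn).le h5 (by positivity) (hlam0 n hn).le
        rw [div_mul_eq_mul_div, le_div_iff₀ hc]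
        linarith
      rw [tendsto_zero_iff_norm_tendsto_zero]
      simpa using h2.sqrt
    refine hu.2 z₀ ⟨?_, ?_⟩
    · refine mem_viSolutions_of_tendsto_inner hCne hCcl hCcv hf₁.inner_nonneg hf₁.lipschitzWith
        hc hUc hM hz₀ (hU1.mono hzP) ?_ ?_
      · have h1 := (hη0.add htF).add hr0
        rw [add_zero, add_zero] at h1
        refine h1.congr fun n => ?_
        simp only [hr]
        abel
      · have h1 : Tendsto (fun n => ContinuousLinearMap.adjoint A (b n)) U (𝓝 0) := by
          simpa [Function.comp_def] using
            ((ContinuousLinearMap.adjoint A).continuous.tendsto 0).comp hb0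
        have h2 : Tendsto (fun n => lam n • ContinuousLinearMap.adjoint A (b n)) U (𝓝 0) := by
          refine squeeze_zero_norm' (a := fun n => τ₁ * ‖ContinuousLinearMap.adjoint A (b n)‖) ?_ ?_
          · filter_upwards [hU1] with n hn
            rw [norm_smul, Real.norm_of_nonneg (hlam0 n hn).le]
            exact mul_le_mul_of_nonneg_right (hlamM n hn) (norm_nonneg _)
          · simpa using h1.norm.const_mul τ₁
        simpa using (h2.add htF).neg
    · refine mem_viSolutions_of_tendsto_inner hQne hQcl hQcv hf₂.inner_nonneg hf₂.lipschitzWith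
        hc hUc (x := fun n => A (z n)) (ξ := fun _ => 0)
        (p := fun n => metricProj Q (A (z n) - lam n • f₂ (A (z n)))) (M := ‖A‖ * M)
        (fun n => (A.le_opNorm _).trans (mul_le_mul_of_nonneg_left (hM n) (norm_nonneg _)))
        (fun h => ?_) (Eventually.of_forall fun n => by rw [add_zero]) hb0 tendsto_const_nhds
      simpa only [ContinuousLinearMap.adjoint_inner_left] using
        hz₀ (ContinuousLinearMap.adjoint A h)
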